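/- Let $D$ be a finite strict digraph (no loops, no parallel arcs), let $S\subseteq V(D)$, and let $H=D\langle S\rangle$ be the subdigraph of $D$ induced by $S$. Two vertices $u,v$ are called adjacent if $(u,v)$ or $(v,u)$ is an arc. Let $M$ be a maximum matching of $H$ (that is, of the underlying simple graph of $H$), with $|M|=m>0$, let $V(M)$ be the set of vertices covered by $M$, and let $X=S\setminus V(M)$. For $x\in X$ let $M_x$ be the set of edges of $M$ that have at least one end adjacent to $x$ in $H$. A closed ditrail is a closed directed walk that uses no arc twice (vertices may repeat). The set $S$ is closed-trailable in $D$ if $D$ contains a closed ditrail that passes through all vertices of $S$; and $D$ is $S$-strictly strong if there are two distinct nonadjacent vertices $u,v\in S$ such that $D$ contains a closed ditrail through $u$ and $v$. Suppose that the following holds: if $X=\{x,x'\}$ with $x\neq x'$, and $|M_x|=\frac m2$ or $|M_{x'}|=\frac m2$, then $D$ is $S$-strictly strong. If the minimum semi-degree satisfies $\delta^0(H)\ge m$, i.e. every vertex of $H$ has in-degree at least $m$ and out-degree at least $m$ in $H$, then $S$ is closed-trailable in $D$. -/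

import Mathlib

namespace Digraph

variable {V : Type*}

/-- The subdigraph `D⟨S⟩` induced by a set `S` of vertices. -/
def inducedOn (D : Digraph V) (S : Set V) : Digraph S where
  Adj u v := D.Adj u v

/-- `u` and `v` are adjacent: `(u, v)` or `(v, u)` is an arc. -/
def IsAdjacent (D : Digraph V) (u v : V) : Prop := D.Adj u v ∨ D.Adj v u

/-- The out-neighbourhood of `v`. -/
def outNbhd (D : Digraph V) (v : V) : Set V := {u | u ≠ v ∧ D.Adj v u}

/-- The in-neighbourhood of `v`. -/
def inNbhd (D : Digraph V) (v : V) : Set V := {u | u ≠ v ∧ D.Adj u v}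

/-- The out-degree of `v`. -/
noncomputable def outDeg (D : Digraph V) (v : V) : ℕ := (D.outNbhd v).ncard

/-- The in-degree of `v`. -/
noncomputable def inDeg (D : Digraph V) (v : V) : ℕ := (D.inNbhd v).ncard

/-- The minimum semi-degree `δ⁰(D) = min {δ⁺(D), δ⁻(D)}` (of a finite digraph with at least one
vertex). -/
noncomputable def minSemidegree (D : Digraph V) : ℕ := min (⨅ v, D.outDeg v) (⨅ v, D.inDeg v)

/-- Directed walks from one vertex to another. -/
inductive DiWalk (D : Digraph V) : V → V → Type _
  | nil (u : V) : DiWalk D u u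
  | cons {u v w : V} (h : D.Adj u v) (p : DiWalk D v w) : DiWalk D u w

namespace DiWalk

/-- The list of vertices visited by a directed walk, in order. -/
def support {D : Digraph V} : {u v : V} → D.DiWalk u v → List V
  | _, _, nil u => [u]
  | u, _, cons _ p => u :: p.support

/-- The list of arcs traversed by a directed walk, in order. -/
def arcs {D : Digraph V} : {u v : V} → D.DiWalk u v → List (V × V)
  | _, _, nil _ => []
  | u, _, cons (v := v) _ p => (u, v) :: p.arcs

/-- A ditrail is a directed walk that uses no arc twice. -/
def IsDitrail {D : Digraph V} {u v : V} (p : D.DiWalk u v) : Prop := p.arcs.Nodup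

end DiWalk

/-- `D` contains a closed ditrail through all the vertices of `T`. -/
def HasClosedDitrailThrough (D : Digraph V) (T : Set V) : Prop :=
  ∃ (u : V) (Q : D.DiWalk u u), Q.IsDitrail ∧ ∀ v ∈ T, v ∈ Q.support

/-- `S` is closed-trailable in `D`. -/
def IsClosedTrailable (D : Digraph V) (S : Set V) : Prop := D.HasClosedDitrailThrough S

/-- `D` is `S`-strictly strong: some closed ditrail of `D` passes through two (distinct)
nonadjacent vertices of `S`. -/
def IsStrictlyStrong (D : Digraph V) (S : Set V) : Prop :=
  ∃ u ∈ S, ∃ v ∈ S, u ≠ v ∧ ¬ D.IsAdjacent u v ∧ D.HasClosedDitrailThrough {u, v}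

/-- The underlying graph `UG(D)`. -/
abbrev UG (D : Digraph V) : SimpleGraph V := D.toSimpleGraphInclusive

/-- `M` is a maximum matching of `D`, that is, of its underlying graph. -/
def IsMaximumMatching (D : Digraph V) (M : D.UG.Subgraph) : Prop :=
  M.IsMatching ∧ ∀ M' : D.UG.Subgraph, M'.IsMatching → M'.edgeSet.ncard ≤ M.edgeSet.ncard

/-- `M_x`: the edges of `M` that have an end adjacent to `x` in `D`. -/
def matchingEdgesAt (D : Digraph V) (M : D.UG.Subgraph) (x : V) : Set (Sym2 V) :=
  {e | e ∈ M.edgeSet ∧ ∃ u ∈ e, D.IsAdjacent u x}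

end Digraph

/-!
Suppose first that `M` misses at most one vertex, so that `|S| ≤ 2m + 1`. Then every pair of
vertices satisfies Ore's degree condition in `D⟨S⟩`. Let `C` be a largest closed ditrail inside `S`.
Maximality of `C` makes `S \ C` satisfy Ore's condition again, so by induction `S \ C`, if nonempty,
is the vertex set of a closed ditrail; a detour of `C` through that ditrail would be longer than
`C`. Hence `C` visits all of `S`.

Otherwise `M` misses two vertices `x ≠ x'`. Exchanging an edge of `M` at a neighbour of `x` shows
that the mates of `N(x)` lie outside `N(x')`. With the bound `m` on the semi-degrees this gives
`|N(x)| = |N(x')| = m`, so the arcs at `x` run in both directions; by the same argument so do those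
at every vertex missed by some maximum matching, such as the mates of `N(x)`. Closed ditrails
absorb vertices to which they are joined in both directions. If `N(x)` and `N(x')` share a vertex,
the trivial ditrail at `x` absorbs all of `S`. If they are disjoint, then `X = {x, x'}`,
`|M_x| = m / 2`, and all arcs of `D⟨S⟩` run in both directions; the hypothesis supplies a closed
ditrail through two nonadjacent vertices, which absorbs all neighbours of both and so has at least
`m + 2` vertices in `S`. At most `m` of the `2m + 2` vertices of `S` remain outside, too few for a
vertex together with its neighbours.
-/

namespace ClosedDitrail

open Digraph

section Walks

variable {V : Type*} {D : Digraph V}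

/-- The concatenation of two directed walks. -/
def append : {u v w : V} → D.DiWalk u v → D.DiWalk v w → D.DiWalk u w
  | _, _, _, .nil _, q => q
  | _, _, _, .cons h p, q => .cons h (append p q)

theorem start_mem_support {u v : V} (p : D.DiWalk u v) : u ∈ p.support := by
  cases p <;> simp [DiWalk.support]

theorem end_mem_support {u v : V} (p : D.DiWalk u v) : v ∈ p.support := by
  induction p with
  | nil u => simp [DiWalk.support]
  | cons _ p ih => simp [DiWalk.support, ih]

theorem arcs_append {u v w : V} (p : D.DiWalk u v) (q : D.DiWalk v w) :
    (append p q).arcs = p.arcs ++ q.arcs := by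
  induction p with
  | nil u => rfl
  | cons h p ih => simp [append, DiWalk.arcs, ih]

theorem mem_support_append {u v w y : V} (p : D.DiWalk u v) (q : D.DiWalk v w) :
    y ∈ (append p q).support ↔ y ∈ p.support ∨ y ∈ q.support := by
  induction p with
  | nil u =>
    simp only [append, DiWalk.support, List.mem_singleton, iff_or_self]
    rintro rfl
    exact start_mem_support q
  | cons h p ih => simp [append, DiWalk.support, ih, or_assoc]

theorem mem_support_of_mem_arcs {u v a b : V} (p : D.DiWalk u v) (h : (a, b) ∈ p.arcs) :
    a ∈ p.support ∧ b ∈ p.support := by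
  induction p with
  | nil u => simp [DiWalk.arcs] at h
  | cons huv p ih =>
    have hstart := start_mem_support p
    simp only [DiWalk.arcs, List.mem_cons, Prod.mk.injEq] at h
    simp only [DiWalk.support, List.mem_cons]
    grind

theorem exists_append_eq_of_first_mem {u v : V} (p : D.DiWalk u v) {B : Set V}
    (hB : ∃ y ∈ p.support, y ∈ B) :
    ∃ z ∈ B, ∃ (p₁ : D.DiWalk u z) (p₂ : D.DiWalk z v),
      append p₁ p₂ = p ∧ ∀ y ∈ p₁.support, y ∈ B → y = z := by
  induction p with
  | nil u => exact ⟨u, by simpa [DiWalk.support] using hB, .nil u, .nil u, rfl,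
      by simp [DiWalk.support]⟩
  | @cons u a v h p ih =>
    by_cases hu : u ∈ B
    · exact ⟨u, hu, .nil u, .cons h p, rfl, by simp [DiWalk.support]⟩
    · obtain ⟨z, hz, p₁, p₂, rfl, hfirst⟩ := ih (by simpa [DiWalk.support, hu] using hB)
      refine ⟨z, hz, .cons h p₁, p₂, rfl, fun y hy hyB => ?_⟩
      rcases List.mem_cons.mp hy with rfl | hy
      · exact absurd hyB hu
      · exact hfirst y hy hyB

theorem exists_append_eq_of_last_mem {u v : V} (p : D.DiWalk u v) {A : Set V}
    (hA : ∃ y ∈ p.support, y ∈ A) :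
    ∃ z ∈ A, ∃ (p₁ : D.DiWalk u z) (p₂ : D.DiWalk z v),
      append p₁ p₂ = p ∧ ∀ y ∈ p₂.support, y ∈ A → y = z := by
  induction p with
  | nil u => exact ⟨u, by simpa [DiWalk.support] using hA, .nil u, .nil u, rfl,
      by simp [DiWalk.support]⟩
  | @cons u a v h p ih =>
    by_cases hp : ∃ y ∈ p.support, y ∈ A
    · obtain ⟨z, hz, p₁, p₂, rfl, hlast⟩ := ih hp
      exact ⟨z, hz, .cons h p₁, p₂, rfl, hlast⟩
    · have hu : u ∈ A := by
        obtain ⟨y, hy, hyA⟩ := hA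
        rcases List.mem_cons.mp hy with rfl | hy
        · exact hyA
        · exact absurd ⟨y, hy, hyA⟩ hp
      refine ⟨u, hu, .nil u, .cons h p, rfl, fun y hy hyA => ?_⟩
      rcases List.mem_cons.mp hy with rfl | hy
      · rfl
      · exact absurd ⟨y, hy, hyA⟩ hp

theorem exists_adj_of_mem_of_notMem {u v : V} (p : D.DiWalk u v) {A : Set V} (hu : u ∈ A)
    (hv : v ∉ A) : ∃ a ∈ A, ∃ b ∈ p.support, b ∉ A ∧ D.Adj a b := by
  induction p with
  | nil u => exact absurd hu hv
  | @cons u a v h p ih =>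
    by_cases ha : a ∈ A
    · obtain ⟨b, hb, c, hc, hcA, hbc⟩ := ih ha hv
      exact ⟨b, hb, c, List.mem_cons_of_mem _ hc, hcA, hbc⟩
    · exact ⟨u, hu, a, List.mem_cons_of_mem _ (start_mem_support p), ha, h⟩

theorem isDitrail_append_detour {w z v y : V} {p : D.DiWalk z w} {q : D.DiWalk v y}
    (hp : p.IsDitrail) (hq : q.IsDitrail) (hdisj : ∀ a ∈ q.support, a ∉ p.support)
    (hwv : D.Adj w v) (hyz : D.Adj y z) :
    (append p (.cons hwv (append q (.cons hyz (.nil z))))).IsDitrail := by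
  have hv := hdisj v (start_mem_support q)
  have hy := hdisj y (end_mem_support q)
  have hz := start_mem_support p
  have hw := end_mem_support p
  have hparcs := fun a b => mem_support_of_mem_arcs (a := a) (b := b) p
  have hqarcs := fun a b => mem_support_of_mem_arcs (a := a) (b := b) q
  simp only [DiWalk.IsDitrail] at hp hq ⊢
  simp only [arcs_append, DiWalk.arcs, List.nodup_append', List.nodup_cons, List.mem_append,
    List.disjoint_left, List.mem_cons, Prod.forall, Prod.mk.injEq]
  grind

end Walks

section ClosedDitrailSets

variable {V : Type*} {D : Digraph V} {S C T : Set V}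

/-- `C` is the set of vertices of a closed ditrail of `D`. -/
def IsClosedDitrailSet (D : Digraph V) (C : Set V) : Prop :=
  ∃ (u : V) (Q : D.DiWalk u u), Q.IsDitrail ∧ {v | v ∈ Q.support} = C

theorem isClosedDitrailSet_singleton (u : V) : IsClosedDitrailSet D {u} :=
  ⟨u, .nil u, List.nodup_nil, by simp [DiWalk.support]⟩

theorem hasClosedDitrailThrough_iff :
    D.HasClosedDitrailThrough T ↔ ∃ C, IsClosedDitrailSet D C ∧ T ⊆ C := by
  constructor
  · rintro ⟨u, Q, hQ, hT⟩
    exact ⟨_, ⟨u, Q, hQ, rfl⟩, hT⟩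
  · rintro ⟨_, ⟨u, Q, hQ, rfl⟩, hT⟩
    exact ⟨u, Q, hQ, hT⟩

namespace IsClosedDitrailSet

theorem nonempty (hC : IsClosedDitrailSet D C) : C.Nonempty := by
  obtain ⟨u, Q, -, rfl⟩ := hC
  exact ⟨u, start_mem_support Q⟩

theorem exists_diWalk (hC : IsClosedDitrailSet D C) {w : V} (hw : w ∈ C) :
    ∃ Q : D.DiWalk w w, Q.IsDitrail ∧ {v | v ∈ Q.support} = C := by
  obtain ⟨u, Q, hQ, rfl⟩ := hC
  obtain ⟨_, rfl, Q₁, Q₂, rfl, -⟩ := exists_append_eq_of_first_mem Q (B := {w}) ⟨w, hw, rfl⟩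
  refine ⟨append Q₂ Q₁, ?_, ?_⟩
  · rw [DiWalk.IsDitrail, arcs_append] at hQ ⊢
    exact List.nodup_append_comm.mp hQ
  · ext y
    simp only [Set.mem_ofPred_eq, mem_support_append, or_comm]

theorem union_support (hC : IsClosedDitrailSet D C) {w v y : V} (hw : w ∈ C)
    {p : D.DiWalk v y} (hp : p.IsDitrail) (hdisj : ∀ a ∈ p.support, a ∉ C) (hwv : D.Adj w v)
    (hyw : D.Adj y w) : IsClosedDitrailSet D (C ∪ {a | a ∈ p.support}) := by
  obtain ⟨Q, hQ, rfl⟩ := hC.exists_diWalk hw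
  refine ⟨w, _, isDitrail_append_detour hQ hp hdisj hwv hyw, ?_⟩
  ext a
  have hstart := start_mem_support Q
  have hend := end_mem_support p
  simp only [mem_support_append, DiWalk.support, List.mem_cons, Set.mem_ofPred_eq, Set.mem_union]
  grind

theorem insert (hC : IsClosedDitrailSet D C) {w v : V} (hw : w ∈ C) (hv : v ∉ C)
    (hwv : D.Adj w v) (hvw : D.Adj v w) : IsClosedDitrailSet D (insert v C) := by
  have h := hC.union_support hw (p := .nil v) List.nodup_nil (by simpa [DiWalk.support]) hwv hvw
  rwa [DiWalk.support, Set.union_comm, show {a | a ∈ [v]} = {v} by simp, Set.singleton_union] at h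

/-- Leaving the trail at the last in-neighbour of `v` before its first out-neighbour and returning
at that out-neighbour skips no neighbour of `v`. -/
theorem exists_detour (hC : IsClosedDitrailSet D C) (hT : IsClosedDitrailSet D T)
    (hdisj : Disjoint T C) {v : V} (hv : v ∈ T) (hin : ∃ w ∈ C, D.Adj w v)
    (hout : ∃ z ∈ C, D.Adj v z) :
    ∃ C', IsClosedDitrailSet D C' ∧ C' ⊆ C ∪ T ∧ T ⊆ C' ∧ ∀ y ∈ C, D.IsAdjacent y v → y ∈ C' := by
  obtain ⟨w₀, hw₀, hw₀v⟩ := hin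
  obtain ⟨Q, hQ, rfl⟩ := hC.exists_diWalk hw₀
  obtain ⟨R, hR, rfl⟩ := hT.exists_diWalk hv
  obtain ⟨z, hvz, Q₁, Q₂, rfl, hfirst⟩ :=
    exists_append_eq_of_first_mem Q (B := {z | D.Adj v z}) hout
  obtain ⟨w, hwv, P₁, P₂, rfl, hlast⟩ :=
    exists_append_eq_of_last_mem Q₁ (A := {w | D.Adj w v}) ⟨w₀, start_mem_support Q₁, hw₀v⟩
  have hrest : (append Q₂ P₁).IsDitrail := by
    simp only [DiWalk.IsDitrail, arcs_append, List.append_assoc] at hQ ⊢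
    exact List.nodup_append_comm.mp (hQ.sublist ((List.sublist_append_right _ _).append_left _))
  refine ⟨_, ⟨z, _, isDitrail_append_detour hrest hR ?_ hwv hvz, rfl⟩, ?_, ?_, ?_⟩
  · exact fun a ha ha' => Set.disjoint_left.mp hdisj ha (by
      simp only [Set.mem_ofPred_eq, mem_support_append] at ha' ⊢
      tauto)
  all_goals
    have hz := start_mem_support Q₂
    have hw := end_mem_support P₁
    simp only [Set.subset_def, Set.mem_union, Set.mem_ofPred_eq, mem_support_append, DiWalk.support,
      List.mem_cons, Digraph.IsAdjacent] at hfirst hlast ⊢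
    grind

theorem exists_saturated (hC : IsClosedDitrailSet D C) (hS : S.Finite) :
    ∃ C', IsClosedDitrailSet D C' ∧ C ⊆ C' ∧
      ∀ w ∈ C', ∀ v ∈ S, D.Adj w v → D.Adj v w → v ∈ C' := by
  obtain ⟨C', ⟨hC', hCC'⟩, hmax⟩ := Set.Finite.exists_maximalFor' (fun C' : Set V => C' ∩ S)
    {C' | IsClosedDitrailSet D C' ∧ C ⊆ C'}
    (hS.finite_subsets.subset (Set.image_subset_iff.mpr fun _ _ => Set.inter_subset_right))
    ⟨C, hC, subset_rfl⟩
  refine ⟨C', hC', hCC', fun w hw v hv hwv hvw => ?_⟩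
  by_contra hvC'
  have hsub : C' ⊆ Insert.insert v C' := Set.subset_insert v C'
  exact hvC' (hmax ⟨hC'.insert hw hvC' hwv hvw, hCC'.trans hsub⟩
    (Set.inter_subset_inter_left S hsub) ⟨Set.mem_insert v C', hv⟩).1

end IsClosedDitrailSet

end ClosedDitrailSets

section DenseSets

variable {V : Type*} {D : Digraph V} {S C R : Set V}

/-- Ore's degree condition for the subdigraph induced by `S`, imposed on all pairs of vertices. The
case `u = v` is included, so that the condition passes to `S \ C`. -/
def IsOreDense (D : Digraph V) (S : Set V) : Prop :=
  ∀ u ∈ S, ∀ v ∈ S, S.ncard ≤ (D.outNbhd u ∩ S).ncard + (D.inNbhd v ∩ S).ncard + 1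

/-- `C` is the vertex set of a closed ditrail inside `S` visiting as many vertices as possible. -/
structure IsLargestClosedDitrailSet (D : Digraph V) (S C : Set V) : Prop where
  subset : C ⊆ S
  isClosedDitrailSet : IsClosedDitrailSet D C
  ncard_le : ∀ C' ⊆ S, IsClosedDitrailSet D C' → C'.ncard ≤ C.ncard

theorem exists_isLargestClosedDitrailSet (hS : S.Finite) (hne : S.Nonempty) :
    ∃ C, IsLargestClosedDitrailSet D S C := by
  obtain ⟨s, hs⟩ := hne
  obtain ⟨C, ⟨hCS, hC⟩, hmax⟩ := Set.exists_max_image {C | C ⊆ S ∧ IsClosedDitrailSet D C} Set.ncard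
    (hS.finite_subsets.subset fun C hC => hC.1)
    ⟨{s}, Set.singleton_subset_iff.mpr hs, isClosedDitrailSet_singleton s⟩
  exact ⟨C, hCS, hC, fun C' hC'S hC' => hmax C' ⟨hC'S, hC'⟩⟩

theorem ncard_inter_eq_add_diff (hS : S.Finite) (hCS : C ⊆ S) (N : Set V) :
    (N ∩ S).ncard = (N ∩ C).ncard + (N ∩ (S \ C)).ncard := by
  rw [← Set.ncard_union_eq (Set.disjoint_sdiff_right.mono Set.inter_subset_right
    Set.inter_subset_right) ((hS.subset hCS).inter_of_right N) (hS.sdiff.inter_of_right N),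
    ← Set.inter_union_distrib_left, Set.union_sdiff_cancel hCS]

theorem ncard_outNbhd_inter_lt (hR : R.Finite) {v : V} (hv : v ∈ R) :
    (D.outNbhd v ∩ R).ncard < R.ncard :=
  Set.ncard_lt_ncard ⟨Set.inter_subset_right, fun h => (h hv).1.1 rfl⟩ hR

theorem ncard_inNbhd_inter_lt (hR : R.Finite) {v : V} (hv : v ∈ R) :
    (D.inNbhd v ∩ R).ncard < R.ncard :=
  Set.ncard_lt_ncard ⟨Set.inter_subset_right, fun h => (h hv).1.1 rfl⟩ hR

theorem exists_ditrail_of_ncard_lt (hR : R.Finite) {a b : V} (ha : a ∈ R) (hb : b ∈ R)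
    (hab : a ≠ b) (h : R.ncard < (D.outNbhd a ∩ R).ncard + (D.inNbhd b ∩ R).ncard + 2) :
    ∃ p : D.DiWalk a b, p.IsDitrail ∧ ∀ y ∈ p.support, y ∈ R := by
  by_cases hadj : D.Adj a b
  · exact ⟨.cons hadj (.nil b), List.nodup_singleton _, by simp [DiWalk.support, ha, hb]⟩
  have hout : D.outNbhd a ∩ R ⊆ R \ {a, b} := by
    rintro c ⟨⟨hca, hac⟩, hc⟩
    exact ⟨hc, by rintro (rfl | rfl) <;> contradiction⟩
  have hin : D.inNbhd b ∩ R ⊆ R \ {a, b} := by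
    rintro c ⟨⟨hcb, hbc⟩, hc⟩
    exact ⟨hc, by rintro (rfl | rfl) <;> contradiction⟩
  have hcard : (R \ {a, b}).ncard + 2 = R.ncard := by
    rw [← Set.ncard_pair hab]
    exact Set.ncard_sdiff_add_ncard_of_subset (Set.pair_subset ha hb) hR
  obtain ⟨c, ⟨⟨hca, hac⟩, hc⟩, ⟨-, hcb⟩, -⟩ :
      ((D.outNbhd a ∩ R) ∩ (D.inNbhd b ∩ R)).Nonempty := by
    by_contra hempty
    have hunion := Set.ncard_union_eq
      (Set.disjoint_iff_inter_eq_empty.mpr (Set.not_nonempty_iff_eq_empty.mp hempty))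
      (hR.inter_of_right _) (hR.inter_of_right _)
    have hle := Set.ncard_le_ncard (Set.union_subset hout hin) hR.sdiff
    omega
  exact ⟨.cons hac (.cons hcb (.nil b)), by simp [DiWalk.IsDitrail, DiWalk.arcs, hca.symm],
    by simp [DiWalk.support, ha, hb, hc]⟩

theorem IsOreDense.exists_adj_diff (hD : IsOreDense D S) (hS : S.Finite) (hCS : C ⊆ S)
    (hC : C.Nonempty) (hR : (S \ C).Nonempty) : ∃ a ∈ C, ∃ b ∈ S \ C, D.Adj a b := by
  obtain ⟨c, hc⟩ := hC
  obtain ⟨d, hd, hdC⟩ := hR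
  obtain ⟨p, -, hp⟩ := exists_ditrail_of_ncard_lt (D := D) hS (hCS hc) hd
    (ne_of_mem_of_not_mem hc hdC) (Nat.lt_succ_of_le (hD c (hCS hc) d hd))
  obtain ⟨a, ha, b, hb, hbC, hab⟩ := exists_adj_of_mem_of_notMem p hc hdC
  exact ⟨a, ha, b, ⟨hp b hb, hbC⟩, hab⟩

namespace IsLargestClosedDitrailSet

theorem disjoint_nbhds (hC : IsLargestClosedDitrailSet D S C) (hS : S.Finite) {a b : V}
    {p : D.DiWalk a b} (hp : p.IsDitrail) (hpR : ∀ y ∈ p.support, y ∈ S \ C) :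
    Disjoint (D.inNbhd a ∩ C) (D.outNbhd b ∩ C) := by
  refine Set.disjoint_left.mpr ?_
  rintro w ⟨⟨-, hwa⟩, hwC⟩ ⟨⟨-, hbw⟩, -⟩
  have hsub : C ∪ {y | y ∈ p.support} ⊆ S := Set.union_subset hC.subset fun y hy => (hpR y hy).1
  have hle := hC.ncard_le _ hsub
    (hC.isClosedDitrailSet.union_support hwC hp (fun y hy => (hpR y hy).2) hwa hbw)
  have ha := start_mem_support p
  refine hle.not_gt (Set.ncard_lt_ncard ⟨Set.subset_union_left, fun h => (hpR a ha).2 (h ?_)⟩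
    (hS.subset hsub))
  exact Or.inr ha

theorem ncard_diff_le_of_ditrail (hC : IsLargestClosedDitrailSet D S C) (hS : S.Finite)
    (hD : IsOreDense D S) {a b : V} {p : D.DiWalk a b} (hp : p.IsDitrail)
    (hpR : ∀ y ∈ p.support, y ∈ S \ C) :
    (S \ C).ncard ≤ (D.outNbhd b ∩ (S \ C)).ncard + (D.inNbhd a ∩ (S \ C)).ncard + 1 := by
  have hfin : C.Finite := hS.subset hC.subset
  have hdense := hD b (hpR b (end_mem_support p)).1 a (hpR a (start_mem_support p)).1
  have hle : (D.inNbhd a ∩ C).ncard + (D.outNbhd b ∩ C).ncard ≤ C.ncard := by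
    rw [← Set.ncard_union_eq (hC.disjoint_nbhds hS hp hpR) (hfin.inter_of_right _)
      (hfin.inter_of_right _)]
    exact Set.ncard_le_ncard (Set.union_subset Set.inter_subset_right Set.inter_subset_right) hfin
  have hcard := Set.ncard_sdiff_add_ncard_of_subset hC.subset hS
  rw [ncard_inter_eq_add_diff hS hC.subset, ncard_inter_eq_add_diff hS hC.subset] at hdense
  omega

theorem isOreDense_diff (hC : IsLargestClosedDitrailSet D S C) (hS : S.Finite)
    (hD : IsOreDense D S) : IsOreDense D (S \ C) := by
  intro u hu v hv
  have hdiag : ∀ w ∈ S \ C, (S \ C).ncard ≤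
      (D.outNbhd w ∩ (S \ C)).ncard + (D.inNbhd w ∩ (S \ C)).ncard + 1 := fun w hw =>
    hC.ncard_diff_le_of_ditrail hS hD (p := .nil w) List.nodup_nil (by simpa [DiWalk.support])
  rcases eq_or_ne v u with rfl | hvu
  · exact hdiag v hv
  rcases lt_or_ge (S \ C).ncard
    ((D.outNbhd v ∩ (S \ C)).ncard + (D.inNbhd u ∩ (S \ C)).ncard + 2) with hlt | hge
  · obtain ⟨p, hp, hpR⟩ := exists_ditrail_of_ncard_lt hS.sdiff hv hu hvu hlt
    exact hC.ncard_diff_le_of_ditrail hS hD hp hpR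
  · have := hdiag u hu
    have := hdiag v hv
    omega

theorem exists_mem_diff_adj (hC : IsLargestClosedDitrailSet D S C) (hS : S.Finite)
    (hD : IsOreDense D S) (hne : (S \ C).Nonempty) (hle : (S \ C).ncard ≤ C.ncard) :
    ∃ v ∈ S \ C, (∃ w ∈ C, D.Adj w v) ∧ ∃ z ∈ C, D.Adj v z := by
  have hor : ∀ u ∈ S \ C, ∀ v ∈ S \ C, (∃ z ∈ C, D.Adj u z) ∨ ∃ w ∈ C, D.Adj w v := by
    intro u hu v hv
    by_contra! hnot
    have hout : D.outNbhd u ∩ C = ∅ :=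
      Set.eq_empty_of_forall_notMem fun z hz => hnot.1 z hz.2 hz.1.2
    have hin : D.inNbhd v ∩ C = ∅ :=
      Set.eq_empty_of_forall_notMem fun w hw => hnot.2 w hw.2 hw.1.2
    have hdense := hD u hu.1 v hv.1
    rw [ncard_inter_eq_add_diff hS hC.subset, ncard_inter_eq_add_diff hS hC.subset, hout, hin,
      Set.ncard_empty] at hdense
    have hcard := Set.ncard_sdiff_add_ncard_of_subset hC.subset hS
    have := ncard_outNbhd_inter_lt (D := D) hS.sdiff hu
    have := ncard_inNbhd_inter_lt (D := D) hS.sdiff hv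
    omega
  obtain ⟨w, hw, v, hv, hwv⟩ :=
    hD.exists_adj_diff hS hC.subset hC.isClosedDitrailSet.nonempty hne
  obtain ⟨u, hu, z, hz, huz⟩ := hD.exists_adj_diff (C := S \ C) hS Set.sdiff_subset hne
    (by rw [Set.sdiff_sdiff_cancel_left hC.subset]; exact hC.isClosedDitrailSet.nonempty)
  rw [Set.sdiff_sdiff_cancel_left hC.subset] at hz
  by_cases hu_in : ∃ w ∈ C, D.Adj w u
  · exact ⟨u, hu, hu_in, z, hz, huz⟩
  · exact ⟨v, hv, ⟨w, hw, hwv⟩, (hor v hv u hu).resolve_right hu_in⟩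

theorem not_isClosedDitrailSet_diff (hC : IsLargestClosedDitrailSet D S C)
    (hS : S.Finite) (hD : IsOreDense D S) : ¬ IsClosedDitrailSet D (S \ C) := by
  intro hR
  obtain ⟨v, hv, hin, hout⟩ := hC.exists_mem_diff_adj hS hD hR.nonempty
    (hC.ncard_le _ Set.sdiff_subset hR)
  obtain ⟨C', hC', hC'S, hRC', hnbrs⟩ :=
    hC.isClosedDitrailSet.exists_detour hR Set.disjoint_sdiff_left hv hin hout
  rw [Set.union_sdiff_cancel hC.subset] at hC'S
  have hfin : C.Finite := hS.subset hC.subset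
  have hdisj := hC.disjoint_nbhds hS (p := .nil v) List.nodup_nil (by simpa [DiWalk.support])
  have hdense := hD v hv.1 v hv.1
  rw [ncard_inter_eq_add_diff hS hC.subset, ncard_inter_eq_add_diff hS hC.subset] at hdense
  set A := D.inNbhd v ∩ C
  set B := D.outNbhd v ∩ C
  have hABC : A ∪ B ⊆ C := Set.union_subset Set.inter_subset_right Set.inter_subset_right
  have hlarge : (A.ncard + B.ncard) + (S \ C).ncard ≤ C.ncard := by
    rw [← Set.ncard_union_eq hdisj (hfin.inter_of_right _) (hfin.inter_of_right _),
      ← Set.ncard_union_eq (Set.disjoint_sdiff_right.mono_left hABC) (hfin.subset hABC) hS.sdiff]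
    refine le_trans (Set.ncard_le_ncard (Set.union_subset ?_ hRC') (hS.subset hC'S))
      (hC.ncard_le C' hC'S hC')
    rintro y (⟨⟨-, hyv⟩, hy⟩ | ⟨⟨-, hvy⟩, hy⟩)
    · exact hnbrs y hy (Or.inl hyv)
    · exact hnbrs y hy (Or.inr hvy)
  have hcard := Set.ncard_sdiff_add_ncard_of_subset hC.subset hS
  have := ncard_outNbhd_inter_lt (D := D) hS.sdiff hv
  have := ncard_inNbhd_inter_lt (D := D) hS.sdiff hv
  omega

end IsLargestClosedDitrailSet

theorem IsOreDense.isClosedDitrailSet (hD : IsOreDense D S) (hS : S.Finite) (hne : S.Nonempty) :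
    IsClosedDitrailSet D S := by
  induction hn : S.ncard using Nat.strong_induction_on generalizing S with
  | _ n ih =>
    obtain ⟨C, hC⟩ := exists_isLargestClosedDitrailSet (D := D) hS hne
    rcases (S \ C).eq_empty_or_nonempty with hempty | hR
    · rw [(Set.sdiff_eq_empty.mp hempty).antisymm hC.subset]
      exact hC.isClosedDitrailSet
    · have hlt : (S \ C).ncard < n := by
        obtain ⟨c, hc⟩ := hC.isClosedDitrailSet.nonempty
        exact hn ▸ Set.ncard_lt_ncard ⟨Set.sdiff_subset, fun h => (h (hC.subset hc)).2 hc⟩ hS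
      exact absurd (ih _ hlt (hC.isOreDense_diff hS hD) hS.sdiff hR rfl)
        (hC.not_isClosedDitrailSet_diff hS hD)

end DenseSets

section Semidegree

variable {V : Type*} {D : Digraph V} {S : Set V}

theorem minSemidegree_le_outDeg (v : V) : D.minSemidegree ≤ D.outDeg v :=
  (min_le_left _ _).trans (ciInf_le (OrderBot.bddBelow _) v)

theorem minSemidegree_le_inDeg (v : V) : D.minSemidegree ≤ D.inDeg v :=
  (min_le_right _ _).trans (ciInf_le (OrderBot.bddBelow _) v)

theorem outNbhd_subset_neighborSet (v : V) : D.outNbhd v ⊆ D.UG.neighborSet v :=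
  fun _ h => ⟨h.1.symm, Or.inl h.2⟩

theorem inNbhd_subset_neighborSet (v : V) : D.inNbhd v ⊆ D.UG.neighborSet v :=
  fun _ h => ⟨h.1.symm, Or.inr h.2⟩

theorem minSemidegree_le_ncard_neighborSet [Finite V] (v : V) :
    D.minSemidegree ≤ (D.UG.neighborSet v).ncard :=
  (minSemidegree_le_outDeg v).trans (Set.ncard_le_ncard (outNbhd_subset_neighborSet v))

theorem adj_and_adj_of_ncard_neighborSet_le [Finite V] {v w : V}
    (h : (D.UG.neighborSet v).ncard ≤ D.minSemidegree) (hvw : D.UG.Adj v w) :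
    D.Adj v w ∧ D.Adj w v := by
  have hout := Set.eq_of_subset_of_ncard_le (outNbhd_subset_neighborSet v)
    (h.trans (minSemidegree_le_outDeg v))
  have hin := Set.eq_of_subset_of_ncard_le (inNbhd_subset_neighborSet v)
    (h.trans (minSemidegree_le_inDeg v))
  have hw : w ∈ D.UG.neighborSet v := hvw
  exact ⟨(hout ▸ hw : w ∈ D.outNbhd v).2, (hin ▸ hw : w ∈ D.inNbhd v).2⟩

theorem outDeg_inducedOn (v : S) : (D.inducedOn S).outDeg v = (D.outNbhd v ∩ S).ncard := by
  rw [Digraph.outDeg, ← Set.ncard_image_of_injective _ Subtype.val_injective]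
  congr 1
  ext u
  simp [Digraph.outNbhd, Digraph.inducedOn, Subtype.ext_iff, and_comm, and_left_comm]

theorem inDeg_inducedOn (v : S) : (D.inducedOn S).inDeg v = (D.inNbhd v ∩ S).ncard := by
  rw [Digraph.inDeg, ← Set.ncard_image_of_injective _ Subtype.val_injective]
  congr 1
  ext u
  simp [Digraph.inNbhd, Digraph.inducedOn, Subtype.ext_iff, and_comm, and_left_comm]

theorem isOreDense_of_ncard_le (h : S.ncard ≤ 2 * (D.inducedOn S).minSemidegree + 1) :
    IsOreDense D S := by
  intro u hu v hv
  have hout := minSemidegree_le_outDeg (D := D.inducedOn S) ⟨u, hu⟩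
  have hin := minSemidegree_le_inDeg (D := D.inducedOn S) ⟨v, hv⟩
  simp only [outDeg_inducedOn] at hout
  simp only [inDeg_inducedOn] at hin
  omega

end Semidegree

section Matchings

open SimpleGraph.Subgraph

variable {α : Type*} {G : SimpleGraph α} {M : G.Subgraph}

/-- The vertices matched by `M` to a vertex of `N`. -/
def mates (M : G.Subgraph) (N : Set α) : Set α := {v | ∃ w ∈ N, M.Adj w v}

theorem mates_subset_verts (N : Set α) : mates M N ⊆ M.verts := fun _ ⟨_, _, h⟩ => h.snd_mem

theorem ncard_mates (hM : M.IsMatching) {N : Set α} (hN : N ⊆ M.verts) :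
    (mates M N).ncard = N.ncard := by
  have hmate : ∀ w : N, ∃ v, M.Adj w v := fun w => (hM (hN w.2)).exists
  choose mate hmate using hmate
  refine (Set.ncard_congr (t := mates M N) (fun w hw => mate ⟨w, hw⟩)
    (fun w hw => ⟨w, hw, hmate ⟨w, hw⟩⟩) ?_ ?_).symm
  · exact fun w w' hw hw' h => hM.eq_of_adj_right (hmate ⟨w, hw⟩) (h ▸ hmate ⟨w', hw'⟩)
  · rintro v ⟨w, hw, hwv⟩
    exact ⟨w, hw, hM.eq_of_adj_left (hmate ⟨w, hw⟩) hwv⟩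

theorem two_mul_ncard_of_subset_edgeSet [Finite α] (hM : M.IsMatching) {E : Set (Sym2 α)}
    (hE : E ⊆ M.edgeSet) : 2 * E.ncard = (⋃ e ∈ E, (e : Set α)).ncard := by
  have htwo : ∀ e ∈ E, (e : Set α).ncard = 2 := by
    intro e he
    induction e with
    | h a b =>
      rw [Sym2.coe_mk, Set.ncard_pair (hE he : M.Adj a b).ne]
  have hdisj : E.PairwiseDisjoint fun e => (e : Set α) := by
    intro e he f hf hef
    refine Set.disjoint_left.mpr fun v hve hvf => hef ?_
    obtain ⟨a, rfl⟩ : v ∈ e := hve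
    obtain ⟨b, rfl⟩ : v ∈ f := hvf
    exact congrArg (s(v, ·)) (hM.eq_of_adj_left (hE he) (hE hf))
  rw [E.toFinite.ncard_biUnion (fun _ _ => Set.toFinite _) hdisj, finsum_mem_congr rfl htwo,
    ← finsum_one, mul_finsum_mem, mul_one]

theorem two_mul_ncard_edgeSet [Finite α] (hM : M.IsMatching) :
    2 * M.edgeSet.ncard = M.verts.ncard := by
  rw [two_mul_ncard_of_subset_edgeSet hM subset_rfl, hM.verts_eq_biUnion_edgeSet]

theorem isMatching_sup_subgraphOfAdj (hM : M.IsMatching) {x y : α} (hx : x ∉ M.verts)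
    (hy : y ∉ M.verts) (hxy : G.Adj x y) : (M ⊔ G.subgraphOfAdj hxy).IsMatching := by
  refine hM.sup (.subgraphOfAdj hxy) ?_
  rw [hM.support_eq_verts, (IsMatching.subgraphOfAdj hxy).support_eq_verts]
  simp [hx, hy]

theorem isMatching_deleteVerts (hM : M.IsMatching) {w w' : α} (hww' : M.Adj w w') :
    (M.deleteVerts {w, w'}).IsMatching := by
  rintro v ⟨hv, hvw⟩
  obtain ⟨u, hvu, huniq⟩ := hM hv
  refine ⟨u, deleteVerts_adj.mpr ⟨hv, hvw, hvu.snd_mem, ?_, hvu⟩, fun z hz => huniq z (by simp_all)⟩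
  rintro (rfl | rfl)
  · exact hvw (Or.inr (hM.eq_of_adj_right hvu hww'.symm))
  · exact hvw (Or.inl (hM.eq_of_adj_right hvu hww'))

theorem exists_isMatching_exchange (hM : M.IsMatching) {x w w' : α} (hx : x ∉ M.verts)
    (hww' : M.Adj w w') (hxw : G.Adj x w) :
    ∃ M' : G.Subgraph, M'.IsMatching ∧ M'.verts = insert x (M.verts \ {w'}) := by
  refine ⟨_, isMatching_sup_subgraphOfAdj (isMatching_deleteVerts hM hww') (x := x) (y := w)
    (by simp [hx]) (by simp) hxw, ?_⟩
  ext v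
  have hw := hww'.fst_mem
  have hne := hww'.ne
  simp only [verts_sup, deleteVerts_verts, SimpleGraph.subgraphOfAdj_verts, Set.mem_union,
    Set.mem_sdiff, Set.mem_insert_iff, Set.mem_singleton_iff]
  grind

end Matchings

section MaximumMatchings

variable {α : Type*} [Finite α] {H : Digraph α} {M : H.UG.Subgraph} {x x' : α}

theorem ncard_verts_le (hM : H.IsMaximumMatching M) {M' : H.UG.Subgraph} (hM' : M'.IsMatching) :
    M'.verts.ncard ≤ M.verts.ncard := by
  have := hM.2 M' hM'
  rw [← two_mul_ncard_edgeSet hM.1, ← two_mul_ncard_edgeSet hM']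
  omega

theorem isMaximumMatching_of_ncard_verts_le (hM : H.IsMaximumMatching M) {M' : H.UG.Subgraph}
    (hM' : M'.IsMatching) (h : M.verts.ncard ≤ M'.verts.ncard) : H.IsMaximumMatching M' := by
  rw [← two_mul_ncard_edgeSet hM.1, ← two_mul_ncard_edgeSet hM'] at h
  exact ⟨hM', fun N hN => (hM.2 N hN).trans (by omega)⟩

theorem not_adj_of_notMem_verts (hM : H.IsMaximumMatching M) (hx : x ∉ M.verts)
    (hx' : x' ∉ M.verts) : ¬ H.UG.Adj x x' := by
  intro hxx'
  refine (ncard_verts_le hM (isMatching_sup_subgraphOfAdj hM.1 hx hx' hxx')).not_gt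
    (Set.ncard_lt_ncard ⟨fun v hv => Or.inl hv, fun h => hx (h (Or.inr ?_))⟩)
  simp

theorem neighborSet_subset_verts (hM : H.IsMaximumMatching M) (hx : x ∉ M.verts) :
    H.UG.neighborSet x ⊆ M.verts := fun _ hv =>
  not_not.mp fun hv' => not_adj_of_notMem_verts hM hx hv' hv

theorem exists_isMaximumMatching_exchange (hM : H.IsMaximumMatching M) (hx : x ∉ M.verts)
    {v : α} (hv : v ∈ mates M (H.UG.neighborSet x)) :
    ∃ M' : H.UG.Subgraph, H.IsMaximumMatching M' ∧ M'.verts = insert x (M.verts \ {v}) := by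
  obtain ⟨w, hxw, hwv⟩ := hv
  obtain ⟨M', hM', hverts⟩ := exists_isMatching_exchange hM.1 hx hwv hxw
  refine ⟨M', isMaximumMatching_of_ncard_verts_le hM hM' ?_, hverts⟩
  rw [hverts, Set.ncard_insert_of_notMem (fun h => hx h.1),
    Set.ncard_sdiff_singleton_add_one hwv.snd_mem]

/-- Otherwise an exchange would leave two adjacent vertices unmatched. -/
theorem disjoint_mates_neighborSet (hM : H.IsMaximumMatching M) (hx : x ∉ M.verts)
    (hx' : x' ∉ M.verts) (hne : x ≠ x') :
    Disjoint (mates M (H.UG.neighborSet x)) (H.UG.neighborSet x') := by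
  refine Set.disjoint_left.mpr fun v hv hx'v => ?_
  obtain ⟨M', hM', hverts⟩ := exists_isMaximumMatching_exchange hM hx hv
  have hvx : v ≠ x := ne_of_mem_of_not_mem (mates_subset_verts _ hv) hx
  exact not_adj_of_notMem_verts hM' (by simp [hverts, hx', hne.symm]) (by simp [hverts, hvx]) hx'v

theorem ncard_neighborSet_add_le (hM : H.IsMaximumMatching M) (hx : x ∉ M.verts)
    (hx' : x' ∉ M.verts) (hne : x ≠ x') :
    (H.UG.neighborSet x).ncard + (H.UG.neighborSet x').ncard ≤ M.verts.ncard := by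
  rw [← ncard_mates hM.1 (neighborSet_subset_verts hM hx),
    ← Set.ncard_union_eq (disjoint_mates_neighborSet hM hx hx' hne)]
  exact Set.ncard_le_ncard
    (Set.union_subset (mates_subset_verts _) (neighborSet_subset_verts hM hx'))

/-- `v` is missed by some maximum matching: an inessential vertex, in the terminology of the
Gallai–Edmonds decomposition. -/
def IsInessential (H : Digraph α) (v : α) : Prop :=
  ∃ M : H.UG.Subgraph, H.IsMaximumMatching M ∧ v ∉ M.verts

theorem isInessential_of_mem_mates (hM : H.IsMaximumMatching M) (hx : x ∉ M.verts) {v : α}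
    (hv : v ∈ mates M (H.UG.neighborSet x)) : IsInessential H v := by
  obtain ⟨M', hM', hverts⟩ := exists_isMaximumMatching_exchange hM hx hv
  have hvx : v ≠ x := ne_of_mem_of_not_mem (mates_subset_verts _ hv) hx
  exact ⟨M', hM', by simp [hverts, hvx]⟩

section LargeSemidegree

variable (hM : H.IsMaximumMatching M) (hdeg : M.edgeSet.ncard ≤ H.minSemidegree)
  (hx : x ∉ M.verts) (hx' : x' ∉ M.verts) (hne : x ≠ x')

include hM hdeg hx hx' hne

theorem ncard_neighborSet_eq : (H.UG.neighborSet x).ncard = M.edgeSet.ncard := by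
  have := ncard_neighborSet_add_le hM hx hx' hne
  have := hdeg.trans (minSemidegree_le_ncard_neighborSet x)
  have := hdeg.trans (minSemidegree_le_ncard_neighborSet x')
  have := two_mul_ncard_edgeSet hM.1
  omega

theorem adj_and_adj_of_isInessential {v w : α} (hv : IsInessential H v) (hvw : H.UG.Adj v w) :
    H.Adj v w ∧ H.Adj w v := by
  obtain ⟨N, hN, hvN⟩ := hv
  have hedges : N.edgeSet.ncard = M.edgeSet.ncard := (hM.2 N hN.1).antisymm (hN.2 M hM.1)
  have hmiss : 1 < N.vertsᶜ.ncard := by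
    have hMmiss : 1 < M.vertsᶜ.ncard := (Set.one_lt_ncard).mpr ⟨x, hx, x', hx', hne⟩
    have := Set.ncard_add_ncard_compl M.verts
    have := Set.ncard_add_ncard_compl N.verts
    have := two_mul_ncard_edgeSet hM.1
    have := two_mul_ncard_edgeSet hN.1
    omega
  obtain ⟨v', hv'N, hv'v⟩ := Set.exists_ne_of_one_lt_ncard hmiss v
  refine adj_and_adj_of_ncard_neighborSet_le ?_ hvw
  rw [ncard_neighborSet_eq hN (hedges ▸ hdeg) hvN hv'N hv'v.symm, hedges]
  exact hdeg

theorem mates_union_neighborSet_eq_verts :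
    mates M (H.UG.neighborSet x) ∪ H.UG.neighborSet x' = M.verts := by
  refine Set.eq_of_subset_of_ncard_le
    (Set.union_subset (mates_subset_verts _) (neighborSet_subset_verts hM hx')) ?_
  rw [Set.ncard_union_eq (disjoint_mates_neighborSet hM hx hx' hne),
    ncard_mates hM.1 (neighborSet_subset_verts hM hx), ncard_neighborSet_eq hM hdeg hx hx' hne,
    ncard_neighborSet_eq hM hdeg hx' hx hne.symm, ← two_mul, two_mul_ncard_edgeSet hM.1]

end LargeSemidegree

/-- `C` is closed under passing from a vertex to one joined to it by arcs in both directions. -/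
def IsBidirClosed (H : Digraph α) (C : Set α) : Prop :=
  ∀ v ∈ C, ∀ w, H.Adj v w → H.Adj w v → w ∈ C

theorem eq_univ_of_isBidirClosed_of_common_neighbor (hM : H.IsMaximumMatching M)
    (hdeg : M.edgeSet.ncard ≤ H.minSemidegree) (hx : x ∉ M.verts) (hx' : x' ∉ M.verts)
    (hne : x ≠ x') {y : α} (hxy : H.UG.Adj x y) (hx'y : H.UG.Adj x' y) {C : Set α}
    (hC : IsBidirClosed H C) (hxC : x ∈ C) : C = Set.univ := by
  have hboth := fun {v w} => adj_and_adj_of_isInessential (v := v) (w := w) hM hdeg hx hx' hne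
  have hstep : ∀ v ∈ C, IsInessential H v → H.UG.neighborSet v ⊆ C := fun v hvC hv w hvw =>
    hC v hvC w (hboth hv hvw).1 (hboth hv hvw).2
  have hstep' : ∀ v, IsInessential H v → ∀ w ∈ C, H.UG.Adj v w → v ∈ C := fun v hv w hw hvw =>
    hC w hw v (hboth hv hvw).2 (hboth hv hvw).1
  have hmiss : ∀ v ∉ M.verts, IsInessential H v := fun v hv => ⟨M, hM, hv⟩
  have hxN := hstep x hxC (hmiss x hx)
  have hx'N := hstep x' (hstep' x' (hmiss x' hx') y (hxN hxy) hx'y) (hmiss x' hx')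
  have hmates : mates M (H.UG.neighborSet x) ⊆ C := fun v hv =>
    have ⟨w, hxw, hwv⟩ := hv
    hstep' v (isInessential_of_mem_mates hM hx hv) w (hxN hxw) hwv.symm.adj_sub
  have hverts : M.verts ⊆ C := by
    rw [← mates_union_neighborSet_eq_verts hM hdeg hx hx' hne]
    exact Set.union_subset hmates hx'N
  refine Set.eq_univ_of_forall fun v => ?_
  by_cases hv : v ∈ M.verts
  · exact hverts hv
  · have hpos : 0 < (H.UG.neighborSet v).ncard := by
      refine lt_of_lt_of_le ?_ (minSemidegree_le_ncard_neighborSet v)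
      refine lt_of_lt_of_le ?_ hdeg
      rw [← ncard_neighborSet_eq hM hdeg hx hx' hne]
      exact (Set.ncard_pos).mpr ⟨y, hxy⟩
    obtain ⟨w, hvw⟩ := Set.nonempty_of_ncard_ne_zero hpos.ne'
    exact hstep' v (hmiss v hv) w (hverts (neighborSet_subset_verts hM hv hvw)) hvw

section DisjointNeighborhoods

variable (hM : H.IsMaximumMatching M) (hdeg : M.edgeSet.ncard ≤ H.minSemidegree)
  (hx : x ∉ M.verts) (hx' : x' ∉ M.verts) (hne : x ≠ x')
  (hdisj : Disjoint (H.UG.neighborSet x) (H.UG.neighborSet x'))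

include hM hdeg hx hx' hne hdisj

theorem neighborSet_union_eq_verts : H.UG.neighborSet x ∪ H.UG.neighborSet x' = M.verts := by
  refine Set.eq_of_subset_of_ncard_le
    (Set.union_subset (neighborSet_subset_verts hM hx) (neighborSet_subset_verts hM hx')) ?_
  rw [Set.ncard_union_eq hdisj, ncard_neighborSet_eq hM hdeg hx hx' hne,
    ncard_neighborSet_eq hM hdeg hx' hx hne.symm, ← two_mul, two_mul_ncard_edgeSet hM.1]

theorem mates_neighborSet_eq : mates M (H.UG.neighborSet x) = H.UG.neighborSet x := by
  refine Set.eq_of_subset_of_ncard_le ?_ (ncard_mates hM.1 (neighborSet_subset_verts hM hx)).ge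
  refine (disjoint_mates_neighborSet hM hx hx' hne).subset_left_of_subset_union ?_
  rw [neighborSet_union_eq_verts hM hdeg hx hx' hne hdisj]
  exact mates_subset_verts _

theorem isInessential_of_disjoint_neighborSet (v : α) : IsInessential H v := by
  by_cases hv : v ∈ M.verts
  · rw [← neighborSet_union_eq_verts hM hdeg hx hx' hne hdisj] at hv
    rcases hv with hv | hv
    · rw [← mates_neighborSet_eq hM hdeg hx hx' hne hdisj] at hv
      exact isInessential_of_mem_mates hM hx hv
    · rw [← mates_neighborSet_eq hM hdeg hx' hx hne.symm hdisj.symm] at hv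
      exact isInessential_of_mem_mates hM hx' hv
  · exact ⟨M, hM, hv⟩

theorem compl_verts_eq_pair (hpos : 0 < M.edgeSet.ncard) : M.vertsᶜ = {x, x'} := by
  refine Set.Subset.antisymm (fun z hz => ?_) (Set.pair_subset hx hx')
  by_contra hzxx'
  obtain ⟨hzx, hzx'⟩ : z ≠ x ∧ z ≠ x' := by simpa using hzxx'
  obtain ⟨w, hzw⟩ : (H.UG.neighborSet z).Nonempty := Set.nonempty_of_ncard_ne_zero
    (ncard_neighborSet_eq hM hdeg hz hx hzx ▸ hpos).ne'
  have hw := neighborSet_subset_verts hM hz hzw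
  rw [← neighborSet_union_eq_verts hM hdeg hx hx' hne hdisj,
    ← mates_neighborSet_eq hM hdeg hx hx' hne hdisj,
    ← mates_neighborSet_eq hM hdeg hx' hx hne.symm hdisj.symm] at hw
  rcases hw with hw | hw
  · exact Set.disjoint_left.mp (disjoint_mates_neighborSet hM hx hz hzx.symm) hw hzw
  · exact Set.disjoint_left.mp (disjoint_mates_neighborSet hM hx' hz hzx'.symm) hw hzw

theorem two_mul_ncard_matchingEdgesAt :
    2 * (H.matchingEdgesAt M x).ncard = M.edgeSet.ncard := by
  rw [two_mul_ncard_of_subset_edgeSet hM.1 fun e he => he.1,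
    ← ncard_neighborSet_eq hM hdeg hx hx' hne]
  congr 1
  have hmates := mates_neighborSet_eq hM hdeg hx hx' hne hdisj
  ext v
  simp only [Set.mem_iUnion₂]
  constructor
  · rintro ⟨e, ⟨he, u, hue, hux⟩, hve⟩
    obtain ⟨w, rfl⟩ := hue
    have huw : M.Adj u w := he
    have hxu : H.UG.Adj x u := ⟨(ne_of_mem_of_not_mem huw.fst_mem hx).symm, hux.symm⟩
    rcases Sym2.mem_iff.mp hve with rfl | rfl
    · exact hxu
    · exact hmates ▸ ⟨u, hxu, huw⟩
  · intro hxv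
    obtain ⟨w, hvw, -⟩ := hM.1 (neighborSet_subset_verts hM hx hxv)
    exact ⟨s(v, w), ⟨hvw, v, Sym2.mem_mk_left v w, hxv.2.symm⟩, Sym2.mem_mk_left v w⟩

end DisjointNeighborhoods

theorem eq_univ_of_isBidirClosed_of_not_adj
    (hboth : ∀ v w, H.UG.Adj v w → H.Adj v w ∧ H.Adj w v)
    (hcard : Nat.card α ≤ 2 * H.minSemidegree + 2) {C : Set α} (hC : IsBidirClosed H C) {a b : α}
    (ha : a ∈ C) (hb : b ∈ C) (hab : a ≠ b) (hnadj : ¬ H.UG.Adj a b) : C = Set.univ := by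
  have hclosed : ∀ v ∈ C, ∀ w, H.UG.Adj v w → w ∈ C := fun v hv w hvw =>
    hC v hv w (hboth v w hvw).1 (hboth v w hvw).2
  refine Set.eq_univ_of_forall fun z => by_contra fun hz => ?_
  have houter : (insert z (H.UG.neighborSet z)).ncard ≤ Cᶜ.ncard :=
    Set.ncard_le_ncard (Set.insert_subset hz fun w hzw hw => hz (hclosed w hw z hzw.symm))
  have hinner : (insert b (insert a (H.UG.neighborSet a))).ncard ≤ C.ncard :=
    Set.ncard_le_ncard (Set.insert_subset hb (Set.insert_subset ha (hclosed a ha)))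
  rw [Set.ncard_insert_of_notMem (H.UG.notMem_neighborSet_self)] at houter
  rw [Set.ncard_insert_of_notMem (by simp [hab.symm, hnadj]),
    Set.ncard_insert_of_notMem (H.UG.notMem_neighborSet_self)] at hinner
  have := minSemidegree_le_ncard_neighborSet (D := H) z
  have := minSemidegree_le_ncard_neighborSet (D := H) a
  have := Set.ncard_add_ncard_compl C
  omega

end MaximumMatchings

section Closure

variable {V : Type*} {D : Digraph V} {S T : Set V}

theorem hasClosedDitrailThrough_singleton (v : V) : D.HasClosedDitrailThrough {v} :=
  hasClosedDitrailThrough_iff.mpr ⟨{v}, isClosedDitrailSet_singleton v, subset_rfl⟩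

theorem hasClosedDitrailThrough_of_isBidirClosed (hS : S.Finite)
    (hT : D.HasClosedDitrailThrough T)
    (hclosure : ∀ C : Set S, IsBidirClosed (D.inducedOn S) C → (∀ v : S, ↑v ∈ T → v ∈ C) →
      C = Set.univ) : D.HasClosedDitrailThrough S := by
  obtain ⟨C₀, hC₀, hTC₀⟩ := hasClosedDitrailThrough_iff.mp hT
  obtain ⟨C, hC, hC₀C, hsat⟩ := hC₀.exists_saturated hS
  have huniv := hclosure {v : S | (v : V) ∈ C}
    (fun v hv w hvw hwv => hsat v hv w w.2 hvw hwv) fun v hv => hC₀C (hTC₀ hv)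
  exact hasClosedDitrailThrough_iff.mpr
    ⟨C, hC, fun v hv => Set.eq_univ_iff_forall.mp huniv ⟨v, hv⟩⟩

theorem hasClosedDitrailThrough_of_isStrictlyStrong [Finite S] (hD : D.IsStrictlyStrong S)
    (hboth : ∀ v w, (D.inducedOn S).UG.Adj v w →
      (D.inducedOn S).Adj v w ∧ (D.inducedOn S).Adj w v)
    (hcard : S.ncard ≤ 2 * (D.inducedOn S).minSemidegree + 2) : D.HasClosedDitrailThrough S := by
  obtain ⟨a, ha, b, hb, hab, hnadj, htrail⟩ := hD
  refine hasClosedDitrailThrough_of_isBidirClosed S.toFinite htrail fun C hC hmem => ?_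
  exact eq_univ_of_isBidirClosed_of_not_adj hboth hcard hC
    (hmem ⟨a, ha⟩ (by simp)) (hmem ⟨b, hb⟩ (by simp)) (by simpa using hab) fun h => hnadj h.2

theorem IsOreDense.hasClosedDitrailThrough (hD : IsOreDense D S) (hS : S.Finite)
    (hne : S.Nonempty) : D.HasClosedDitrailThrough S :=
  hasClosedDitrailThrough_iff.mpr ⟨S, hD.isClosedDitrailSet hS hne, subset_rfl⟩

end Closure

end ClosedDitrail

open ClosedDitrail

theorem mainTheorem2_general {V : Type*} (D : Digraph V) (S : Set V) [Finite S]
    (M : (D.inducedOn S).UG.Subgraph) (m : ℕ)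
    (hM : (D.inducedOn S).IsMaximumMatching M) (hcard : M.edgeSet.ncard = m) (hm : 0 < m)
    (hexc : ∀ x x' : S, x ≠ x' → M.vertsᶜ = {x, x'} →
      (2 * ((D.inducedOn S).matchingEdgesAt M x).ncard = m ∨
        2 * ((D.inducedOn S).matchingEdgesAt M x').ncard = m) →
      D.IsStrictlyStrong S)
    (hdeg : m ≤ (D.inducedOn S).minSemidegree) :
    D.IsClosedTrailable S := by
  subst hcard
  have hsize : 2 * M.edgeSet.ncard + M.vertsᶜ.ncard = S.ncard := by
    rw [two_mul_ncard_edgeSet hM.1, Set.ncard_add_ncard_compl, Nat.card_coe_set_eq]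
  rcases Nat.lt_or_ge 1 M.vertsᶜ.ncard with hmiss | hmiss
  · obtain ⟨x, hx, x', hx', hne⟩ := (Set.one_lt_ncard).mp hmiss
    by_cases hdisj : Disjoint ((D.inducedOn S).UG.neighborSet x)
        ((D.inducedOn S).UG.neighborSet x')
    · have hpair := compl_verts_eq_pair hM hdeg hx hx' hne hdisj hm
      have hhalf := two_mul_ncard_matchingEdgesAt hM hdeg hx hx' hne hdisj
      refine hasClosedDitrailThrough_of_isStrictlyStrong (hexc x x' hne hpair (Or.inl hhalf))
        (fun v w => adj_and_adj_of_isInessential hM hdeg hx hx' hne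
          (isInessential_of_disjoint_neighborSet hM hdeg hx hx' hne hdisj v)) ?_
      rw [hpair, Set.ncard_pair hne] at hsize
      omega
    · obtain ⟨y, hxy, hx'y⟩ := Set.not_disjoint_iff.mp hdisj
      refine hasClosedDitrailThrough_of_isBidirClosed S.toFinite
        (hasClosedDitrailThrough_singleton (x : V)) fun C hC hxC => ?_
      exact eq_univ_of_isBidirClosed_of_common_neighbor hM hdeg hx hx' hne hxy hx'y hC (hxC x rfl)
  · have hdense : IsOreDense D S := isOreDense_of_ncard_le (by omega)
    exact hdense.hasClosedDitrailThrough S.toFinite (Set.nonempty_of_ncard_ne_zero (by omega))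

theorem mainTheorem2 {V : Type*} [Finite V] (D : Digraph V) (hD : ∀ v, ¬ D.Adj v v)
    (S : Set V) (M : (D.inducedOn S).UG.Subgraph) (m : ℕ)
    (hM : (D.inducedOn S).IsMaximumMatching M) (hcard : M.edgeSet.ncard = m) (hm : 0 < m)
    (hexc : ∀ x x' : S, x ≠ x' → M.vertsᶜ = {x, x'} →
      (2 * ((D.inducedOn S).matchingEdgesAt M x).ncard = m ∨
        2 * ((D.inducedOn S).matchingEdgesAt M x').ncard = m) →
      D.IsStrictlyStrong S)
    (hdeg : m ≤ (D.inducedOn S).minSemidegree) :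
    D.IsClosedTrailable S :=
  mainTheorem2_general D S M m hM hcard hm hexc hdeg
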